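/- For an integer $k\ge 1$ let $f_k=\prod_{i\ge 1}(1-q^{ki})\in\mathbb{Z}[[q]]$, and define integers $P^\ast(n)$ for $n\ge 0$ by $$\sum_{n\ge 0}P^\ast(n)q^n=f_1^4f_5^4 .$$ Then for all integers $n\ge 0$, $$P^\ast(2n+1)\equiv 0 \pmod 4,\qquad P^\ast(4n+3)\equiv 0 \pmod 8,\qquad P^\ast(16n+7)=0.$$ -/

import Mathlib

noncomputable section

open PowerSeries
open scoped PowerSeries.WithPiTopology

/-- The infinite `q`-Pochhammer symbol `(a; b)_∞ = ∏_{i ≥ 0} (1 - a b^i)` of formal power series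
over `ℤ`; the infinite product is taken coefficientwise (product topology, `ℤ` discrete). -/
def qPochhammerInf (a b : PowerSeries ℤ) : PowerSeries ℤ :=
  ∏' i : ℕ, (1 - a * b ^ i)

/-- `f_k = (q^k; q^k)_∞`, the formal variable `q` being `X`. -/
def eulerF (k : ℕ) : PowerSeries ℤ :=
  qPochhammerInf (X ^ k) (X ^ k)

/-- `P*(n)`, the coefficient of `q^n` in `f_1^4 f_5^4`. -/
def Pstar (n : ℕ) : ℤ :=
  coeff n (eulerF 1 ^ 4 * eulerF 5 ^ 4)

/-- The product that defines `f_k` converges for every `k ≥ 1`, so that it takes no default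
value. -/
theorem multipliable_eulerF {k : ℕ} (hk : 1 ≤ k) :
    Multipliable fun i : ℕ => (1 - X ^ k * (X ^ k) ^ i : PowerSeries ℤ) := by
  simp_rw [sub_eq_add_neg]
  apply PowerSeries.WithPiTopology.multipliable_one_add_of_tendsto_order_atTop_nhds_top
  refine ENat.tendsto_nhds_top_iff_natCast_lt.mpr fun n => Filter.eventually_atTop.mpr ⟨n, ?_⟩
  intro m hm
  rw [order_neg, ← pow_mul, ← pow_add, order_X_pow]
  norm_cast
  nlinarith

end

/-! Write F(q) = f_1^4 f_5^4. Then qF(q) is an eigenform of the Hecke operator at 2, which amounts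
to P*(2n+1) = -4 P*(n) - 8 P*((n-1)/2), the last term being absent for even n. All three claims
follow from this recursion.

The recursion is proved with theta series: φ(q) = ∑ q^(n^2) and Ψ(q) = ∑ q^(n(n+1)/2), both over all
integers, so that Ψ is twice Gauss' series. Gauss' product f_1^2 = φ(-q) f_2 (`eulerF_sq`) and
φ(-q)^2 = φ(q^2)^2 - qΨ(q^4)^2 (`thetaPhiNeg_sq`) give the odd part of F as -q f_2^2 f_10^2
(Ψ(q^4)^2 φ(q^10)^2 + q^4 φ(q^2)^2 Ψ(q^20)^2). The bracket is a sum of two squares. The square of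
their difference comes from 2 f_1 f_5 = φ(q^5)Ψ(q^2) - qφ(q)Ψ(q^10) at q^2
(`two_mul_eulerF_one_mul_eulerF_five`), and the cross term from `thetaPsi_sq` and
`eulerF_mul_thetaPsi`. The odd part is thus -q(4F(q^2) + 8q^2 F(q^4)). -/

noncomputable section

open PowerSeries Finset Filter Topology
open scoped PowerSeries.WithPiTopology

/-! ### Finite forms of Gauss' identities -/

section FiniteIdentities

variable {R : Type*} [CommRing R]

/-- Shanks' finite form of Gauss' identity for `∑ (-1)^n x^(n^2)`. -/
theorem prod_one_add_mul_sum_sq (x : R) (n : ℕ) :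
    (∏ k ∈ range n, (1 + x ^ (k + 1))) *
        (1 + 2 * ∑ s ∈ range n, (-1) ^ (s + 1) * x ^ ((s + 1) ^ 2)) =
      ∏ k ∈ range n, (1 - x ^ (k + 1)) +
        2 * ∑ s ∈ range n, (-1) ^ (s + 1) * x ^ ((s + 1) * (n + 1)) *
          (∏ k ∈ range s, (1 + x ^ (k + 1))) * ∏ k ∈ Ico (s + 1) n, (1 - x ^ (k + 1)) := by
  induction n with
  | zero => simp
  | succ n ih =>
    set Q : ℕ → R := fun s => ∏ k ∈ range s, (1 + x ^ (k + 1)) with hQ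
    set E : ℕ → R := fun s => ∏ k ∈ Ico s n, (1 - x ^ (k + 1)) with hE
    have hQs : ∀ s, Q (s + 1) = Q s * (1 + x ^ (s + 1)) := fun s => prod_range_succ _ _
    have hEs : ∀ s, s < n → E s = (1 - x ^ (s + 1)) * E (s + 1) := fun s hs =>
      prod_eq_prod_Ico_succ_bot hs _
    have hEn : E n = 1 := by simp [hE]
    have hE0 : E 0 = ∏ k ∈ range n, (1 - x ^ (k + 1)) := by simp [hE]
    -- Passing from n to n + 1 multiplies the old terms by 1 + x^(n+1), up to differences of V. In
    -- the end V n joins the new top term, and -V 0 turns 1 - x^(n+1) into 1 + x^(n+1) in front of E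
    -- 0.
    let V : ℕ → R := fun s => (-1) ^ (s + 1) * x ^ ((s + 1) * (n + 1)) * Q s * E s
    have tele : ∑ s ∈ range n, (-1) ^ (s + 1) * x ^ ((s + 1) * (n + 1 + 1)) * Q s *
          ∏ k ∈ Ico (s + 1) (n + 1), (1 - x ^ (k + 1)) =
        (1 + x ^ (n + 1)) * (∑ s ∈ range n, (-1) ^ (s + 1) * x ^ ((s + 1) * (n + 1)) * Q s *
          E (s + 1)) + (V n - V 0) := by
      rw [← sum_range_sub V, mul_sum, ← sum_add_distrib]
      refine sum_congr rfl fun s hs => ?_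
      have hs := mem_range.mp hs
      rw [prod_Ico_succ_top (by omega)]
      simp only [V]
      rw [hQs, hEs s hs]
      change _ * (E (s + 1) * _) = _
      ring
    have ih' : Q n * (1 + 2 * ∑ s ∈ range n, (-1) ^ (s + 1) * x ^ ((s + 1) ^ 2)) =
        E 0 + 2 * ∑ s ∈ range n, (-1) ^ (s + 1) * x ^ ((s + 1) * (n + 1)) * Q s * E (s + 1) := by
      rw [hE0]; exact ih
    change Q (n + 1) * _ = _
    rw [sum_range_succ, sum_range_succ, tele, prod_range_succ, ← hE0, hQs]
    simp only [V, hEn, Ico_self, prod_empty, hQ, range_zero] at *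
    linear_combination (1 + x ^ (n + 1)) * ih'

/-- Shanks' finite form of Gauss' identity for `∑ x^(n(n+1)/2)`. -/
theorem prod_one_sub_odd_mul_sum_triangular (x : R) (n : ℕ) :
    (∏ k ∈ range n, (1 - x ^ (2 * k + 1))) * ∑ j ∈ range (2 * n + 1), x ^ (j * (j + 1) / 2) =
      ∑ s ∈ range (n + 1), x ^ (s * (2 * n + 1)) * (∏ k ∈ range s, (1 - x ^ (2 * k + 1))) *
        ∏ k ∈ Ico s n, (1 - x ^ (2 * (k + 1))) := by
  induction n with
  | zero => simp
  | succ n ih =>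
    set D : ℕ → R := fun s => ∏ k ∈ range s, (1 - x ^ (2 * k + 1)) with hD
    set E : ℕ → R := fun s => ∏ k ∈ Ico s n, (1 - x ^ (2 * (k + 1))) with hE
    have hDs : ∀ s, D (s + 1) = D s * (1 - x ^ (2 * s + 1)) := fun s => prod_range_succ _ _
    have hEs : ∀ s, s < n → E s = (1 - x ^ (2 * (s + 1))) * E (s + 1) := fun s hs =>
      prod_eq_prod_Ico_succ_bot hs _
    have hEn : E n = 1 := by simp [hE]
    -- V s is x^(s(2n+1)) D s E (s-1); the case split avoids the index -1 at s = 0.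
    obtain ⟨V, hV0, hV⟩ : ∃ V : ℕ → R, V 0 = 0 ∧
        ∀ s, V (s + 1) = x ^ ((s + 1) * (2 * n + 1)) * D (s + 1) * E s :=
      ⟨fun s => Nat.casesOn s 0 fun s => x ^ ((s + 1) * (2 * n + 1)) * D (s + 1) * E s,
        rfl, fun _ => rfl⟩
    have tele : ∑ s ∈ range (n + 1), x ^ (s * (2 * (n + 1) + 1)) * D s *
          ∏ k ∈ Ico s (n + 1), (1 - x ^ (2 * (k + 1))) =
        (1 - x ^ (2 * n + 1)) * (∑ s ∈ range (n + 1), x ^ (s * (2 * n + 1)) * D s * E s) +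
          (V (n + 1) - V 0) := by
      rw [← sum_range_sub V (n + 1), mul_sum, ← sum_add_distrib]
      refine sum_congr rfl fun s hs => ?_
      have hs := mem_range.mp hs
      rw [prod_Ico_succ_top (by omega)]
      change _ * (E s * _) = _
      cases s with
      | zero =>
        rw [hV, hV0, hDs]
        simp only [hD, range_zero, prod_empty]
        ring
      | succ s =>
        rw [hV, hV, hDs (s + 1), hEs s (by omega)]
        ring
    have ih' : D n * ∑ j ∈ range (2 * n + 1), x ^ (j * (j + 1) / 2) =
      ∑ s ∈ range (n + 1), x ^ (s * (2 * n + 1)) * D s * E s := ih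
    have e1 : (2 * n + 1) * (2 * n + 1 + 1) / 2 = (n + 1) * (2 * n + 1) :=
      Nat.div_eq_of_eq_mul_left two_pos (by ring)
    have e2 : (2 * n + 1 + 1) * (2 * n + 1 + 1 + 1) / 2 = (n + 1) * (2 * n + 3) :=
      Nat.div_eq_of_eq_mul_left two_pos (by ring)
    have hl : ∑ j ∈ range (2 * (n + 1) + 1), x ^ (j * (j + 1) / 2) =
        ∑ j ∈ range (2 * n + 1), x ^ (j * (j + 1) / 2) + x ^ ((n + 1) * (2 * n + 1)) +
          x ^ ((n + 1) * (2 * n + 3)) := by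
      rw [show 2 * (n + 1) + 1 = 2 * n + 1 + 1 + 1 by ring, sum_range_succ, sum_range_succ, e1, e2]
    rw [hl, sum_range_succ _ (n + 1)]
    change D (n + 1) * _ = ∑ s ∈ range (n + 1), _ * D s * _ + _ * D (n + 1) * _
    rw [tele, hV, hV0, hEn, Ico_self, prod_empty, hDs]
    linear_combination (1 - x ^ (2 * n + 1)) * ih'

end FiniteIdentities

/-! ### Theta series and their summability -/

/-- The triangular number `n (n + 1) / 2` of an integer. -/
def triangular (n : ℤ) : ℕ := (n * (n + 1) / 2).toNat

theorem two_mul_triangular (n : ℤ) : 2 * (triangular n : ℤ) = n * (n + 1) := by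
  have h : 0 ≤ n * (n + 1) := by
    rcases le_or_gt 0 n with h | h <;> nlinarith
  have h2 := Int.two_mul_ediv_two_of_even (Int.even_mul_succ_self n)
  rw [triangular, Int.toNat_of_nonneg (by omega), h2]

/-- `∑ q^(k n^2)` over all integers `n`. -/
def thetaPhi (k : ℕ) : ℤ⟦X⟧ := ∑' n : ℤ, monomial (k * n.natAbs ^ 2) 1

/-- `∑ (-1)^n q^(k n^2)` over all integers `n`. -/
def thetaPhiNeg (k : ℕ) : ℤ⟦X⟧ := ∑' n : ℤ, monomial (k * n.natAbs ^ 2) (n.negOnePow : ℤ)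

/-- `∑ q^(k n (n + 1) / 2)` over all integers `n`. -/
def thetaPsi (k : ℕ) : ℤ⟦X⟧ := ∑' n : ℤ, monomial (k * triangular n) 1

theorem summable_monomial {ι : Type*} {e : ι → ℕ} (he : ∀ d, {i | e i ≤ d}.Finite) (c : ι → ℤ) :
    Summable fun i => (monomial (e i) (c i) : ℤ⟦X⟧) := by
  rw [WithPiTopology.summable_iff_summable_coeff]
  intro d
  refine summable_of_hasFiniteSupport ((he d).subset fun i hi => ?_)
  by_contra h
  refine hi ?_
  dsimp only
  rw [coeff_monomial, if_neg]
  rintro rfl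
  exact h (le_refl (e i))

/-- The slack 1 is needed for triangular numbers, since -1 has triangular number 0. -/
theorem finite_le_of_natAbs_le {e : ℤ → ℕ} (he : ∀ n, n.natAbs ≤ e n + 1) (d : ℕ) :
    {n | e n ≤ d}.Finite := by
  refine (Set.finite_Icc (-(d + 1 : ℤ)) (d + 1)).subset fun n (hn : e n ≤ d) => ?_
  have := he n
  rw [Set.mem_Icc]
  omega

theorem natAbs_le_mul_sq {k : ℕ} (hk : 1 ≤ k) (n : ℤ) : n.natAbs ≤ k * n.natAbs ^ 2 + 1 := by
  nlinarith [sq_nonneg (n.natAbs : ℤ), Nat.le_self_pow two_ne_zero n.natAbs]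

theorem natAbs_le_mul_triangular {k : ℕ} (hk : 1 ≤ k) (n : ℤ) :
    n.natAbs ≤ k * triangular n + 1 := by
  have h := two_mul_triangular n
  have : n.natAbs ≤ triangular n + 1 := by
    zify
    rcases abs_cases n with ⟨h1, h2⟩ | ⟨h1, h2⟩ <;> rw [h1] <;>
      nlinarith [sq_nonneg (n - 1), sq_nonneg (n + 2), sq_nonneg (n + 1)]
  nlinarith

theorem natAbs_le_mul_pentagonal {k : ℕ} (hk : 1 ≤ k) (n : ℤ) :
    n.natAbs ≤ k * pentagonal n + 1 := by
  have h := two_mul_natCast_pentagonal n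
  have : n.natAbs ≤ pentagonal n + 1 := by
    zify
    rcases abs_cases n with ⟨h1, h2⟩ | ⟨h1, h2⟩ <;> rw [h1] <;>
      nlinarith [sq_nonneg (n - 1), sq_nonneg (n + 2), sq_nonneg (n + 1)]
  nlinarith

theorem hasSum_thetaPhi {k : ℕ} (hk : 1 ≤ k) :
    HasSum (fun n : ℤ => (monomial (k * n.natAbs ^ 2) 1 : ℤ⟦X⟧)) (thetaPhi k) :=
  (summable_monomial (finite_le_of_natAbs_le (natAbs_le_mul_sq hk)) _).hasSum

theorem hasSum_thetaPhiNeg {k : ℕ} (hk : 1 ≤ k) :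
    HasSum (fun n : ℤ => (monomial (k * n.natAbs ^ 2) (n.negOnePow : ℤ) : ℤ⟦X⟧)) (thetaPhiNeg k) :=
  (summable_monomial (finite_le_of_natAbs_le (natAbs_le_mul_sq hk)) _).hasSum

theorem hasSum_thetaPsi {k : ℕ} (hk : 1 ≤ k) :
    HasSum (fun n : ℤ => (monomial (k * triangular n) 1 : ℤ⟦X⟧)) (thetaPsi k) :=
  (summable_monomial (finite_le_of_natAbs_le (natAbs_le_mul_triangular hk)) _).hasSum

/-! ### Infinite products as limits and Gauss' product formulas -/

theorem tendsto_zero_of_X_pow_dvd {f : ℕ → ℤ⟦X⟧} (h : ∀ n, X ^ n ∣ f n) :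
    Tendsto f atTop (𝓝 0) := by
  rw [WithPiTopology.tendsto_iff_coeff_tendsto]
  intro d
  refine tendsto_atTop_of_eventually_const (i₀ := d + 1) fun n hn => ?_
  rw [map_zero]
  exact X_pow_dvd_iff.mp (h n) d (by omega)

theorem multipliable_one_add_X_pow {e : ℕ → ℕ} (he : ∀ n, n ≤ e n) (c : ℤ) :
    Multipliable fun n => (1 + C c * X ^ e n : ℤ⟦X⟧) := by
  apply WithPiTopology.multipliable_one_add_of_tendsto_order_atTop_nhds_top
  refine ENat.tendsto_nhds_top_iff_natCast_lt.mpr fun n =>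
    eventually_atTop.mpr ⟨n + 1, fun m hm => ?_⟩
  refine lt_of_lt_of_le ?_ (le_order_mul _ _)
  rw [order_X_pow]
  refine lt_of_lt_of_le (?_ : (n : ℕ∞) < (e m : ℕ∞)) le_add_self
  have := he m
  norm_cast
  omega

theorem multipliable_one_sub_X_pow {e : ℕ → ℕ} (he : ∀ n, n ≤ e n) :
    Multipliable fun n => (1 - X ^ e n : ℤ⟦X⟧) := by
  simpa [sub_eq_add_neg] using multipliable_one_add_X_pow he (-1)

theorem eulerF_eq_tprod (k : ℕ) : eulerF k = ∏' n : ℕ, (1 - X ^ (k * (n + 1))) := by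
  unfold eulerF qPochhammerInf
  refine tprod_congr fun n => ?_
  rw [← pow_mul, ← pow_add]
  ring_nf

theorem multipliable_eulerF_factors {k : ℕ} (hk : 1 ≤ k) :
    Multipliable fun n : ℕ => (1 - X ^ (k * (n + 1)) : ℤ⟦X⟧) :=
  multipliable_one_sub_X_pow fun n => by nlinarith

theorem tendsto_eulerF {k : ℕ} (hk : 1 ≤ k) :
    Tendsto (fun n => ∏ i ∈ range n, (1 - (X ^ k : ℤ⟦X⟧) ^ (i + 1))) atTop (𝓝 (eulerF k)) := by
  simp_rw [← pow_mul]
  rw [eulerF_eq_tprod]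
  exact (multipliable_eulerF_factors hk).hasProd.tendsto_prod_nat

theorem tprod_one_add_mul_eulerF {k : ℕ} (hk : 1 ≤ k) :
    (∏' n : ℕ, (1 + (X : ℤ⟦X⟧) ^ (k * (n + 1)))) * eulerF k = eulerF (2 * k) := by
  have h : Multipliable fun n : ℕ => (1 + X ^ (k * (n + 1)) : ℤ⟦X⟧) := by
    simpa using multipliable_one_add_X_pow (e := fun n => k * (n + 1)) (fun n => by nlinarith) 1
  rw [eulerF_eq_tprod, eulerF_eq_tprod, ← h.tprod_mul (multipliable_eulerF_factors hk)]
  exact tprod_congr fun n => by ring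

theorem tprod_one_sub_odd_mul_eulerF {k : ℕ} (hk : 1 ≤ k) :
    (∏' n : ℕ, (1 - (X : ℤ⟦X⟧) ^ (k * (2 * n + 1)))) * eulerF (2 * k) = eulerF k := by
  rw [eulerF_eq_tprod, eulerF_eq_tprod k,
    ← tprod_even_mul_odd (f := fun n => 1 - (X : ℤ⟦X⟧) ^ (k * (n + 1)))
      (multipliable_one_sub_X_pow (e := fun n => k * (2 * n + 1)) fun n => by nlinarith)
      (multipliable_one_sub_X_pow (e := fun n => k * (2 * n + 1 + 1)) fun n => by nlinarith)]
  congr 1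
  exact tprod_congr fun n => by ring

theorem tendsto_thetaPhiNeg {k : ℕ} (hk : 1 ≤ k) :
    Tendsto (fun n => 1 + 2 * ∑ s ∈ range n, (-1) ^ (s + 1) * (X ^ k : ℤ⟦X⟧) ^ ((s + 1) ^ 2))
      atTop (𝓝 (thetaPhiNeg k)) := by
  set f : ℤ → ℤ⟦X⟧ := fun n => monomial (k * n.natAbs ^ 2) (n.negOnePow : ℤ) with hf
  have hs : Summable f := (hasSum_thetaPhiNeg hk).summable
  have h1 : HasSum (fun n : ℕ => f (n + 1)) (∑' n : ℕ, f (n + 1)) :=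
    (hs.comp_injective (i := fun n : ℕ => (n + 1 : ℤ)) fun a b h => by simpa using h).hasSum
  have hneg : ∀ n, f (-n) = f n := fun n => by simp [hf]
  have h2 : HasSum f (f 0 + 2 * ∑' n : ℕ, f (n + 1)) := by
    rw [two_mul, ← add_assoc]
    refine HasSum.of_nat_of_neg_add_one ?_ ?_
    · refine (hasSum_nat_add_iff' (f := fun n : ℕ => f n) 1).mp ?_
      simpa using h1
    · simpa only [hneg] using h1
  have h3 : thetaPhiNeg k = f 0 + 2 * ∑' n : ℕ, f (n + 1) := (hasSum_thetaPhiNeg hk).unique h2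
  have h4 : f 0 = 1 := by simp [hf]
  have h5 : ∀ s : ℕ, f (s + 1) = (-1) ^ (s + 1) * (X ^ k : ℤ⟦X⟧) ^ ((s + 1) ^ 2) := fun s => by
    have e1 : ((s : ℤ) + 1).natAbs = s + 1 := by omega
    have e2 : (((s : ℤ) + 1).negOnePow : ℤ) = (-1) ^ (s + 1) := by
      rw [show (s : ℤ) + 1 = ((s + 1 : ℕ) : ℤ) by push_cast; rfl, Int.coe_negOnePow_natCast]
    rw [hf]
    simp only [e1, e2]
    rw [monomial_eq_C_mul_X_pow, pow_mul]
    simp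
  rw [h3, h4]
  simpa only [h5] using (h1.tendsto_sum_nat.const_mul 2).const_add 1

/-- The factor 2 arises because n and -1 - n have the same triangular number. -/
theorem tendsto_thetaPsi {k : ℕ} (hk : 1 ≤ k) :
    Tendsto (fun n => 2 * ∑ j ∈ range n, (X ^ k : ℤ⟦X⟧) ^ (j * (j + 1) / 2))
      atTop (𝓝 (thetaPsi k)) := by
  set f : ℤ → ℤ⟦X⟧ := fun n => monomial (k * triangular n) 1 with hf
  have hs : Summable f := (hasSum_thetaPsi hk).summable
  have h1 : HasSum (fun n : ℕ => f n) (∑' n : ℕ, f n) :=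
    (hs.comp_injective (i := fun n : ℕ => (n : ℤ)) Nat.cast_injective).hasSum
  have hneg : ∀ n, f (-(n + 1)) = f n := fun n => by
    simp only [hf, triangular]
    ring_nf
  have h3 : thetaPsi k = 2 * ∑' n : ℕ, f n := by
    refine (hasSum_thetaPsi hk).unique ?_
    have h2 : HasSum (fun n : ℕ => f (-(n + 1))) (∑' n : ℕ, f n) := by simpa only [hneg] using h1
    rw [two_mul]
    exact HasSum.of_nat_of_neg_add_one h1 h2
  have h5 : ∀ s : ℕ, f s = (X ^ k : ℤ⟦X⟧) ^ (s * (s + 1) / 2) := fun s => by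
    have e : triangular s = s * (s + 1) / 2 := by
      rw [triangular]
      norm_cast
    simp only [hf, e]
    rw [monomial_eq_C_mul_X_pow, pow_mul]
    simp
  rw [h3]
  simpa only [h5] using h1.tendsto_sum_nat.const_mul 2

/-- Gauss' product for `∑ (-1)^n q^(n^2)`. -/
theorem eulerF_sq {k : ℕ} (hk : 1 ≤ k) : eulerF k ^ 2 = thetaPhiNeg k * eulerF (2 * k) := by
  have hm : Multipliable fun n : ℕ => (1 + X ^ (k * (n + 1)) : ℤ⟦X⟧) := by
    simpa using multipliable_one_add_X_pow (e := fun n => k * (n + 1)) (fun n => by nlinarith) 1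
  have hQ := hm.hasProd.tendsto_prod_nat
  simp_rw [pow_mul] at hQ
  have hl := hQ.mul (tendsto_thetaPhiNeg hk)
  simp_rw [prod_one_add_mul_sum_sq] at hl
  -- Every term of the correction sum in the finite identity is divisible by X^n, so only the
  -- product survives.
  have hr := (tendsto_eulerF hk).add (tendsto_zero_of_X_pow_dvd (f := fun n =>
      2 * ∑ s ∈ range n, (-1) ^ (s + 1) * (X ^ k : ℤ⟦X⟧) ^ ((s + 1) * (n + 1)) *
          (∏ i ∈ range s, (1 + (X ^ k) ^ (i + 1))) * ∏ i ∈ Ico (s + 1) n, (1 - (X ^ k) ^ (i + 1)))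
      fun n => by
    refine dvd_mul_of_dvd_right (dvd_sum fun s _ => ?_) _
    refine dvd_mul_of_dvd_left (dvd_mul_of_dvd_left (dvd_mul_of_dvd_right ?_ _) _) _
    rw [← pow_mul]
    refine pow_dvd_pow _ ?_
    calc n ≤ 1 * (1 * (n + 1)) := by omega
      _ ≤ k * ((s + 1) * (n + 1)) := by gcongr; omega)
  rw [add_zero] at hr
  have h := tendsto_nhds_unique hl hr
  have h2 := tprod_one_add_mul_eulerF hk
  simp_rw [pow_mul] at h2
  rw [← h2]
  linear_combination (-eulerF k) * h

/-- Gauss' product for `∑ q^(n(n+1)/2)`. -/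
theorem eulerF_mul_thetaPsi {k : ℕ} (hk : 1 ≤ k) :
    eulerF k * thetaPsi k = 2 * eulerF (2 * k) ^ 2 := by
  have hm : Multipliable fun n : ℕ => (1 - X ^ (k * (2 * n + 1)) : ℤ⟦X⟧) :=
    multipliable_one_sub_X_pow fun n => by nlinarith
  have hD : Tendsto (fun n => ∏ i ∈ range n, (1 - (X ^ k : ℤ⟦X⟧) ^ (2 * i + 1))) atTop
      (𝓝 (∏' n : ℕ, (1 - (X : ℤ⟦X⟧) ^ (k * (2 * n + 1))))) := by
    simpa only [pow_mul] using hm.hasProd.tendsto_prod_nat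
  have hodd : Tendsto (fun n : ℕ => 2 * n + 1) atTop atTop :=
    tendsto_atTop_mono (fun n => (by omega : n ≤ 2 * n + 1)) tendsto_id
  have hl := hD.mul ((tendsto_thetaPsi hk).comp hodd)
  have hr := ((tendsto_eulerF (k := 2 * k) (by omega)).add (tendsto_zero_of_X_pow_dvd
      (f := fun n => ∑ s ∈ range n, (X ^ k : ℤ⟦X⟧) ^ ((s + 1) * (2 * n + 1)) *
        (∏ i ∈ range (s + 1), (1 - (X ^ k) ^ (2 * i + 1))) *
        ∏ i ∈ Ico (s + 1) n, (1 - (X ^ k) ^ (2 * (i + 1)))) fun n => by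
    refine dvd_sum fun s _ => dvd_mul_of_dvd_left (dvd_mul_of_dvd_left ?_ _) _
    rw [← pow_mul]
    refine pow_dvd_pow _ ?_
    calc n ≤ 1 * (1 * (2 * n + 1)) := by omega
      _ ≤ k * ((s + 1) * (2 * n + 1)) := by gcongr; omega)).const_mul 2
  have h := tendsto_nhds_unique hl (hr.congr fun n => ?_)
  · have h2 := tprod_one_sub_odd_mul_eulerF hk
    rw [← h2]
    linear_combination eulerF (2 * k) * h
  · simp only [Function.comp_apply]
    rw [mul_left_comm, prod_one_sub_odd_mul_sum_triangular, sum_range_succ', add_comm]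
    simp [← pow_mul, mul_assoc, mul_left_comm]

/-! ### Products and rearrangements of monomial sums -/

theorem hasSum_congr_fun {ι M : Type*} [AddCommMonoid M] [TopologicalSpace M] {f g : ι → M} {a : M}
    (h : ∀ x, f x = g x) : HasSum f a ↔ HasSum g a := by
  rw [funext h]

/-- Power series are functions on exponents with the product topology; `HasSum.mul` needs the
regularity of that space. -/
theorem t3Space_function : T3Space ((Unit →₀ ℕ) → ℤ) := inferInstance

theorem t3Space_powerSeries_int : T3Space ℤ⟦X⟧ := t3Space_function

theorem hasSum_powerSeries_mul {ι κ : Type*} {f : ι → ℤ⟦X⟧} {g : κ → ℤ⟦X⟧} {a b : ℤ⟦X⟧}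
    (ha : HasSum f a) (hb : HasSum g b) (hs : Summable fun p : ι × κ => f p.1 * g p.2) :
    HasSum (fun p : ι × κ => f p.1 * g p.2) (a * b) :=
  haveI := t3Space_powerSeries_int
  ha.mul hb hs

theorem summable_monomial_add {ι κ : Type*} {e : ι → ℕ} {e' : κ → ℕ}
    (he : ∀ d, {i | e i ≤ d}.Finite) (he' : ∀ d, {i | e' i ≤ d}.Finite) (c : ι → ℤ) (c' : κ → ℤ) :
    Summable fun p : ι × κ => (monomial (e p.1 + e' p.2) (c p.1 * c' p.2) : ℤ⟦X⟧) := by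
  refine summable_monomial (e := fun p : ι × κ => e p.1 + e' p.2) (fun d => ?_) _
  refine ((he d).prod (he' d)).subset fun p (hp : e p.1 + e' p.2 ≤ d) => ?_
  exact ⟨le_trans (Nat.le_add_right _ _) hp, le_trans (Nat.le_add_left _ _) hp⟩

theorem hasSum_monomial_mul {ι κ : Type*} {e : ι → ℕ} {e' : κ → ℕ}
    (he : ∀ d, {i | e i ≤ d}.Finite) (he' : ∀ d, {i | e' i ≤ d}.Finite) {c : ι → ℤ} {c' : κ → ℤ}
    {a b : ℤ⟦X⟧} (ha : HasSum (fun i => (monomial (e i) (c i) : ℤ⟦X⟧)) a)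
    (hb : HasSum (fun i => (monomial (e' i) (c' i) : ℤ⟦X⟧)) b) :
    HasSum (fun p : ι × κ => (monomial (e p.1 + e' p.2) (c p.1 * c' p.2) : ℤ⟦X⟧)) (a * b) := by
  have hs := summable_monomial_add he he' c c'
  have h : ∀ p : ι × κ, (monomial (e p.1 + e' p.2) (c p.1 * c' p.2) : ℤ⟦X⟧) =
      (fun i => monomial (e i) (c i)) p.1 * (fun i => monomial (e' i) (c' i)) p.2 :=
    fun p => (monomial_mul_monomial _ _ _ _).symm
  rw [hasSum_congr_fun h]
  rw [summable_congr h] at hs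
  generalize (fun i => (monomial (e i) (c i) : ℤ⟦X⟧)) = f at ha hs ⊢
  generalize (fun i => (monomial (e' i) (c' i) : ℤ⟦X⟧)) = g at hb hs ⊢
  exact hasSum_powerSeries_mul ha hb hs

theorem monomial_congr {a b : ℕ} {c d : ℤ} (h : (a : ℤ) = b) (h' : c = d) :
    (monomial a c : ℤ⟦X⟧) = monomial b d := by
  rw [h', Int.natCast_inj.mp h]

theorem negOnePow_mul_negOnePow (a b : ℤ) :
    (a.negOnePow : ℤ) * (b.negOnePow : ℤ) = ((a + b).negOnePow : ℤ) := by
  rw [Int.negOnePow_add, Units.val_mul]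

theorem coe_negOnePow_even {a : ℤ} (h : Even a) : (a.negOnePow : ℤ) = 1 := by
  rw [Int.negOnePow_even a h, Units.val_one]

theorem coe_negOnePow_odd {a : ℤ} (h : Odd a) : (a.negOnePow : ℤ) = -1 := by
  rw [Int.negOnePow_odd a h, Units.val_neg, Units.val_one]

theorem finite_mul_sq_le {k : ℕ} (hk : 1 ≤ k) (d : ℕ) : {n : ℤ | k * n.natAbs ^ 2 ≤ d}.Finite :=
  finite_le_of_natAbs_le (natAbs_le_mul_sq hk) d

theorem finite_mul_triangular_le {k : ℕ} (hk : 1 ≤ k) (d : ℕ) :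
    {n : ℤ | k * triangular n ≤ d}.Finite :=
  finite_le_of_natAbs_le (natAbs_le_mul_triangular hk) d

theorem finite_mul_pentagonal_le {k : ℕ} (hk : 1 ≤ k) (d : ℕ) :
    {n : ℤ | k * pentagonal n ≤ d}.Finite :=
  finite_le_of_natAbs_le (natAbs_le_mul_pentagonal hk) d

/-- A sum over a type that two injective maps partition. -/
theorem hasSum_add_of_partition {ι α β M : Type*} [AddCommMonoid M] [TopologicalSpace M]
    [ContinuousAdd M] {g : ι → M} {i : α → ι} {j : β → ι} (hi : i.Injective) (hj : j.Injective)
    (hdisj : ∀ x y, i x ≠ j y) (hcov : ∀ z, (∃ x, i x = z) ∨ ∃ y, j y = z) {a b : M}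
    (ha : HasSum (fun x => g (i x)) a) (hb : HasSum (fun y => g (j y)) b) : HasSum g (a + b) := by
  refine HasSum.add_isCompl (s := Set.range i) (t := Set.range j) ?_
    (hi.hasSum_range_iff.mpr ha) (hj.hasSum_range_iff.mpr hb)
  refine IsCompl.of_eq (Set.disjoint_iff_inter_eq_empty.mp (Set.disjoint_left.mpr ?_))
    (Set.eq_univ_of_forall hcov)
  rintro _ ⟨x, rfl⟩ ⟨y, hy⟩
  exact hdisj x y hy.symm

/-- A vanishing sum: a bijection of the index type changes all signs. -/
theorem eq_zero_of_hasSum_of_neg {ι : Type*} {g : ι → ℤ⟦X⟧} (σ : ι ≃ ι)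
    (h : ∀ x, g (σ x) = -g x) {a : ℤ⟦X⟧} (ha : HasSum g a) : a = 0 := by
  have h1 : HasSum (fun x => g (σ x)) a := σ.hasSum_iff.mpr ha
  simp only [h] at h1
  have h2 : a = -a := h1.unique ha.neg
  ext n
  have := congrArg (coeff n) h2
  rw [map_neg] at this
  rw [map_zero]
  omega

/-! ### Squares of theta series -/

theorem thetaPhiNeg_sq {k : ℕ} (hk : 1 ≤ k) :
    thetaPhiNeg k ^ 2 = thetaPhi (2 * k) ^ 2 - X ^ k * thetaPsi (4 * k) ^ 2 := by
  have hk2 : 1 ≤ 2 * k := by omega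
  have hk4 : 1 ≤ 4 * k := by omega
  have h := hasSum_monomial_mul (finite_mul_sq_le hk) (finite_mul_sq_le hk)
    (hasSum_thetaPhiNeg hk) (hasSum_thetaPhiNeg hk)
  have h1 := hasSum_monomial_mul (finite_mul_sq_le hk2) (finite_mul_sq_le hk2)
    (hasSum_thetaPhi hk2) (hasSum_thetaPhi hk2)
  have h2 := (hasSum_monomial_mul (finite_mul_triangular_le hk4) (finite_mul_triangular_le hk4)
    (hasSum_thetaPsi hk4) (hasSum_thetaPsi hk4)).mul_left (monomial k (-1))
  simp_rw [monomial_mul_monomial] at h2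
  -- Pairs of equal parity are (u+v, u-v), those of opposite parity (u+v+1, u-v); the sign is the
  -- parity of the coordinate sum.
  have h3 := h.unique (hasSum_add_of_partition (i := fun p : ℤ × ℤ => (p.1 + p.2, p.1 - p.2))
    (j := fun p : ℤ × ℤ => (p.1 + p.2 + 1, p.1 - p.2)) ?_ ?_ ?_ ?_
    ((hasSum_congr_fun fun p => ?_).mpr h1) ((hasSum_congr_fun fun p => ?_).mpr h2))
  · rw [sq, h3, monomial_eq_C_mul_X_pow, map_neg, map_one]
    ring
  · rintro ⟨a, b⟩ ⟨c, d⟩ h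
    simp only [Prod.mk.injEq] at h ⊢
    omega
  · rintro ⟨a, b⟩ ⟨c, d⟩ h
    simp only [Prod.mk.injEq] at h ⊢
    omega
  · rintro ⟨a, b⟩ ⟨c, d⟩ h
    simp only [Prod.mk.injEq] at h
    omega
  · rintro ⟨a, b⟩
    rcases Int.emod_two_eq_zero_or_one (a + b) with h | h
    · refine Or.inl ⟨((a + b) / 2, (a - b) / 2), ?_⟩
      simp only [Prod.mk.injEq]
      omega
    · refine Or.inr ⟨((a + b) / 2, (a - b) / 2), ?_⟩
      simp only [Prod.mk.injEq]
      omega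
  · obtain ⟨u, v⟩ := p
    refine monomial_congr ?_ ?_
    · push_cast
      simp only [sq_abs]
      ring
    · rw [negOnePow_mul_negOnePow, coe_negOnePow_even ⟨u, by ring⟩, one_mul]
  · obtain ⟨u, v⟩ := p
    refine monomial_congr ?_ ?_
    · push_cast
      simp only [sq_abs]
      linear_combination -2 * (k : ℤ) * (two_mul_triangular u + two_mul_triangular v)
    · rw [negOnePow_mul_negOnePow, coe_negOnePow_odd ⟨u, by ring⟩]
      ring

/-- With T the triangular number, T(v+u) + T(v-u) = u^2 + 2T(v) covers the pairs of equal parity.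
The symmetry a ↦ -1 - a carries the other pairs to these, hence the factor 2. -/
theorem thetaPsi_sq {k : ℕ} (hk : 1 ≤ k) :
    thetaPsi k ^ 2 = 2 * (thetaPhi k * thetaPsi (2 * k)) := by
  have hk2 : 1 ≤ 2 * k := by omega
  have h := hasSum_monomial_mul (finite_mul_triangular_le hk) (finite_mul_triangular_le hk)
    (hasSum_thetaPsi hk) (hasSum_thetaPsi hk)
  have h1 := hasSum_monomial_mul (finite_mul_sq_le hk) (finite_mul_triangular_le hk2)
    (hasSum_thetaPhi hk) (hasSum_thetaPsi hk2)
  have h3 := h.unique (hasSum_add_of_partition (i := fun p : ℤ × ℤ => (p.2 + p.1, p.2 - p.1))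
    (j := fun p : ℤ × ℤ => (-1 - p.2 - p.1, p.2 - p.1)) ?_ ?_ ?_ ?_
    ((hasSum_congr_fun fun p => ?_).mpr h1) ((hasSum_congr_fun fun p => ?_).mpr h1))
  · rw [sq, h3]
    ring
  · rintro ⟨a, b⟩ ⟨c, d⟩ h
    simp only [Prod.mk.injEq] at h ⊢
    omega
  · rintro ⟨a, b⟩ ⟨c, d⟩ h
    simp only [Prod.mk.injEq] at h ⊢
    omega
  · rintro ⟨a, b⟩ ⟨c, d⟩ h
    simp only [Prod.mk.injEq] at h
    omega
  · rintro ⟨a, b⟩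
    rcases Int.emod_two_eq_zero_or_one (a + b) with h | h
    · refine Or.inl ⟨((a - b) / 2, (a + b) / 2), ?_⟩
      simp only [Prod.mk.injEq]
      omega
    · refine Or.inr ⟨((-1 - a - b) / 2, (-1 - a + b) / 2), ?_⟩
      simp only [Prod.mk.injEq]
      omega
  · obtain ⟨u, v⟩ := p
    refine monomial_congr ?_ rfl
    refine mul_left_cancel₀ (two_ne_zero (α := ℤ)) ?_
    push_cast
    simp only [sq_abs]
    linear_combination (k : ℤ) * (two_mul_triangular (v + u) + two_mul_triangular (v - u) -
      2 * two_mul_triangular v)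
  · obtain ⟨u, v⟩ := p
    refine monomial_congr ?_ rfl
    refine mul_left_cancel₀ (two_ne_zero (α := ℤ)) ?_
    push_cast
    simp only [sq_abs]
    linear_combination (k : ℤ) * (two_mul_triangular (-1 - v - u) + two_mul_triangular (v - u) -
      2 * two_mul_triangular v)

/-! ### Substitution of q^k for q, and Euler's pentagonal series -/

theorem continuous_expand {k : ℕ} (hk : k ≠ 0) :
    Continuous (expand k hk : ℤ⟦X⟧ → ℤ⟦X⟧) := by
  refine continuous_iff_continuousAt.mpr fun f => ?_
  rw [ContinuousAt, WithPiTopology.tendsto_iff_coeff_tendsto]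
  intro d
  simp_rw [coeff_expand]
  split_ifs
  · exact (WithPiTopology.continuous_coeff ℤ _).tendsto f
  · exact tendsto_const_nhds

theorem expand_eulerF {k m : ℕ} (hk : k ≠ 0) (hm : 1 ≤ m) :
    expand k hk (eulerF m) = eulerF (k * m) := by
  rw [eulerF_eq_tprod, eulerF_eq_tprod,
    Multipliable.map_tprod (multipliable_eulerF_factors hm) (expand k hk) (continuous_expand hk)]
  refine tprod_congr fun n => ?_
  rw [map_sub, map_one, map_pow, expand_X, ← pow_mul, mul_assoc]

theorem expand_thetaPhi {k m : ℕ} (hk : k ≠ 0) (hm : 1 ≤ m) :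
    expand k hk (thetaPhi m) = thetaPhi (k * m) := by
  rw [thetaPhi, thetaPhi, Summable.map_tsum (hasSum_thetaPhi hm).summable (expand k hk)
    (continuous_expand hk)]
  simp only [expand_monomial, mul_assoc]

theorem expand_thetaPsi {k m : ℕ} (hk : k ≠ 0) (hm : 1 ≤ m) :
    expand k hk (thetaPsi m) = thetaPsi (k * m) := by
  rw [thetaPsi, thetaPsi, Summable.map_tsum (hasSum_thetaPsi hm).summable (expand k hk)
    (continuous_expand hk)]
  simp only [expand_monomial, mul_assoc]

/-- Euler's pentagonal number theorem. -/
theorem hasSum_eulerF {k : ℕ} (hk : 1 ≤ k) :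
    HasSum (fun n : ℤ => (monomial (k * pentagonal n) (n.negOnePow : ℤ) : ℤ⟦X⟧)) (eulerF k) := by
  have h1 : eulerF 1 = pentagonalSeries ℤ := by
    rw [← WithPiTopology.tprod_one_sub_X_pow, eulerF_eq_tprod]
    simp
  have h := (WithPiTopology.hasSum_pentagonalSeries ℤ).map (expand k (by omega))
    (continuous_expand (by omega))
  rw [← h1, expand_eulerF _ le_rfl, mul_one] at h
  refine (hasSum_congr_fun fun n => ?_).mp h
  have hc : ((n.negOnePow : ℤ) : ℤ⟦X⟧) = C (n.negOnePow : ℤ) := by simp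
  simp only [Function.comp_apply]
  rw [hc, ← monomial_eq_C_mul_X_pow, expand_monomial]

/-! ### The theta identity for f_1 f_5 -/

theorem mul_sub_add_pentagonal_nonneg (w v : ℤ) : 0 ≤ w ^ 2 + w - w * v + pentagonal v := by
  have h := two_mul_natCast_pentagonal v
  nlinarith [sq_nonneg (2 * w + 1 - v), sq_nonneg v]

/-- The exponent of the quadratic form attached to the product `f_1 f_5`: four times it, plus one,
is `(2 w + 1 - v)^2 + 5 v^2`. -/
def latticeExponent (p : ℤ × ℤ) : ℕ :=
  (p.1 ^ 2 + p.1 - p.1 * p.2 + pentagonal p.2).toNat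

theorem two_mul_latticeExponent (w v : ℤ) :
    2 * (latticeExponent (w, v) : ℤ) = 2 * w ^ 2 + 2 * w - 2 * w * v + v * (3 * v - 1) := by
  rw [latticeExponent, Int.toNat_of_nonneg (mul_sub_add_pentagonal_nonneg w v)]
  linear_combination two_mul_natCast_pentagonal v

/-- The terms of the signed theta series that equals both sides of the identity for `f_1 f_5`. -/
def latticeTerm (p : ℤ × ℤ) : ℤ⟦X⟧ := monomial (latticeExponent p) (p.2.negOnePow : ℤ)

theorem hasSum_latticeTerm_theta :
    HasSum latticeTerm (thetaPhi 5 * thetaPsi 2 - X * (thetaPhi 1 * thetaPsi 10)) := by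
  have h1 := hasSum_monomial_mul (finite_mul_sq_le (k := 5) (by omega))
    (finite_mul_triangular_le (k := 2) (by omega)) (hasSum_thetaPhi (k := 5) (by omega))
    (hasSum_thetaPsi (by omega))
  have h2 := (hasSum_monomial_mul (finite_mul_sq_le (k := 1) (by omega))
    (finite_mul_triangular_le (k := 10) (by omega)) (hasSum_thetaPhi (k := 1) (by omega))
    (hasSum_thetaPsi (by omega))).mul_left (monomial 1 (-1))
  simp_rw [monomial_mul_monomial] at h2
  have h3 : (monomial 1 (-1) : ℤ⟦X⟧) = -X := by
    rw [monomial_eq_C_mul_X_pow, map_neg, map_one]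
    ring
  rw [sub_eq_add_neg, ← neg_mul, ← h3]
  -- Split by the parity of v: v = 2t makes 2w + 1 - v odd and gives 5t^2 plus twice a triangular
  -- number; v = 2t + 1 makes it even and gives the other product.
  refine hasSum_add_of_partition (i := fun p : ℤ × ℤ => (p.2 + p.1, 2 * p.1))
    (j := fun p : ℤ × ℤ => (p.1 + p.2, 2 * p.2 + 1)) ?_ ?_ ?_ ?_
    ((hasSum_congr_fun fun p => ?_).mpr h1) ((hasSum_congr_fun fun p => ?_).mpr h2)
  · rintro ⟨a, b⟩ ⟨c, d⟩ h
    simp only [Prod.mk.injEq] at h ⊢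
    omega
  · rintro ⟨a, b⟩ ⟨c, d⟩ h
    simp only [Prod.mk.injEq] at h ⊢
    omega
  · rintro ⟨a, b⟩ ⟨c, d⟩ h
    simp only [Prod.mk.injEq] at h
    omega
  · rintro ⟨a, b⟩
    rcases Int.emod_two_eq_zero_or_one b with h | h
    · refine Or.inl ⟨(b / 2, a - b / 2), ?_⟩
      simp only [Prod.mk.injEq]
      omega
    · refine Or.inr ⟨(a - b / 2, b / 2), ?_⟩
      simp only [Prod.mk.injEq]
      omega
  · obtain ⟨t, m⟩ := p
    refine monomial_congr ?_ ?_
    · refine mul_left_cancel₀ (two_ne_zero (α := ℤ)) ?_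
      push_cast
      simp only [sq_abs, two_mul_latticeExponent]
      linear_combination -2 * two_mul_triangular m
    · rw [coe_negOnePow_even ⟨t, by ring⟩, one_mul]
  · obtain ⟨n, t⟩ := p
    refine monomial_congr ?_ ?_
    · refine mul_left_cancel₀ (two_ne_zero (α := ℤ)) ?_
      push_cast
      simp only [sq_abs, two_mul_latticeExponent]
      linear_combination -10 * two_mul_triangular t
    · rw [coe_negOnePow_odd ⟨t, by ring⟩]
      ring

/-- Put x = 2w + 1 - v. Then 6(x^2 + 5v^2) = (x - 5v)^2 + 5(x + v)^2, and here x - 5v = 6m - 1 and x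
+ v = 6n - 1, the square roots in 24·pentagonal + 1. -/
theorem latticeTerm_pentagonal (m n : ℤ) :
    latticeTerm (3 * n - 1, n - m) =
      monomial (1 * pentagonal m + 5 * pentagonal n) ((m.negOnePow : ℤ) * (n.negOnePow : ℤ)) := by
  refine monomial_congr ?_ ?_
  · refine mul_left_cancel₀ (two_ne_zero (α := ℤ)) ?_
    push_cast
    rw [two_mul_latticeExponent]
    linear_combination -two_mul_natCast_pentagonal m - 5 * two_mul_natCast_pentagonal n
  · rw [negOnePow_mul_negOnePow, add_comm, Int.negOnePow_add, Int.negOnePow_sub]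

/-- This is the symmetry (x, v) ↦ (-x, -v) of x^2 + 5v^2, where x = 2w + 1 - v. -/
theorem latticeTerm_neg (w v : ℤ) : latticeTerm (-1 - w, -v) = latticeTerm (w, v) := by
  refine monomial_congr ?_ ?_
  · refine mul_left_cancel₀ (two_ne_zero (α := ℤ)) ?_
    rw [two_mul_latticeExponent, two_mul_latticeExponent]
    ring
  · rw [Int.negOnePow_neg]

/-- With x = 2w + 1 - v, the map negates x - 5v and fixes x + v = 2w + 1. It is integral because w ≡
1 mod 3, and it changes the parity of v. -/
theorem latticeTerm_reflect (m n : ℤ) :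
    latticeTerm (3 * n + 1, n + m + 1) = -latticeTerm (3 * n + 1, n - m) := by
  rw [latticeTerm, latticeTerm, ← map_neg]
  refine monomial_congr ?_ ?_
  · refine mul_left_cancel₀ (two_ne_zero (α := ℤ)) ?_
    rw [two_mul_latticeExponent, two_mul_latticeExponent]
    ring
  · rw [show n + m + 1 = n - m + (2 * m + 1) by ring, Int.negOnePow_add, Units.val_mul,
      coe_negOnePow_odd ⟨m, rfl⟩]
    ring

/-- Sort the lattice sum by w mod 3. The class 2 is f_1 f_5 by the pentagonal number theorem, the
class 0 is its image under the central symmetry, and the class 1 cancels under the reflection. -/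
theorem two_mul_eulerF_one_mul_eulerF_five :
    2 * (eulerF 1 * eulerF 5) = thetaPhi 5 * thetaPsi 2 - X * (thetaPhi 1 * thetaPsi 10) := by
  have h := hasSum_monomial_mul (finite_mul_pentagonal_le (k := 1) (by omega))
    (finite_mul_pentagonal_le (k := 5) (by omega)) (hasSum_eulerF (by omega))
    (hasSum_eulerF (by omega))
  have h1 : HasSum (fun p : ℤ × ℤ => latticeTerm (3 * p.2 - 1, p.2 - p.1))
      (eulerF 1 * eulerF 5) := by
    refine (hasSum_congr_fun fun p => ?_).mpr h
    exact latticeTerm_pentagonal p.1 p.2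
  have h2 : HasSum (fun p : ℤ × ℤ => latticeTerm (-(3 * p.2), p.1 - p.2))
      (eulerF 1 * eulerF 5) := by
    refine (hasSum_congr_fun fun p => ?_).mpr h1
    rw [← latticeTerm_neg]
    congr 2 <;> ring
  let classes : (ℤ × ℤ) ⊕ (ℤ × ℤ) → ℤ × ℤ :=
    Sum.elim (fun p => (3 * p.2 - 1, p.2 - p.1)) (fun p => (-(3 * p.2), p.1 - p.2))
  have h12 : HasSum (fun x => latticeTerm (classes x)) (eulerF 1 * eulerF 5 + eulerF 1 * eulerF 5) :=
    HasSum.sum h1 h2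
  let rest : ℤ × ℤ → ℤ × ℤ := fun p => (3 * p.2 + 1, p.2 - p.1)
  have hinj : classes.Injective := by
    rintro (⟨a, b⟩ | ⟨a, b⟩) (⟨c, d⟩ | ⟨c, d⟩) h <;>
      simp only [classes, Sum.elim_inl, Sum.elim_inr, Prod.mk.injEq, Sum.inl.injEq, Sum.inr.injEq,
        reduceCtorEq] at h ⊢ <;> omega
  have hinj' : rest.Injective := by
    rintro ⟨a, b⟩ ⟨c, d⟩ h
    simp only [rest, Prod.mk.injEq] at h ⊢
    omega
  have h3 : Summable fun p => latticeTerm (rest p) :=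
    (hasSum_latticeTerm_theta.summable).comp_injective hinj'
  have h4 : ∑' p, latticeTerm (rest p) = 0 := by
    -- In the coordinates (m, n) of the class w = 3n + 1, the reflection is m ↦ -1 - m.
    let σ : ℤ × ℤ ≃ ℤ × ℤ := (Equiv.subLeft (-1)).prodCongr (Equiv.refl ℤ)
    refine eq_zero_of_hasSum_of_neg σ (fun p => ?_) h3.hasSum
    change latticeTerm (3 * p.2 + 1, p.2 - (-1 - p.1)) = -latticeTerm (3 * p.2 + 1, p.2 - p.1)
    rw [← latticeTerm_reflect]
    congr 2
    ring
  have h5 := h3.hasSum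
  rw [h4] at h5
  have h6 : HasSum latticeTerm (eulerF 1 * eulerF 5 + eulerF 1 * eulerF 5 + 0) := by
    refine hasSum_add_of_partition hinj hinj' ?_ ?_ h12 h5
    · rintro (⟨a, b⟩ | ⟨a, b⟩) ⟨c, d⟩ h <;>
        simp only [classes, rest, Sum.elim_inl, Sum.elim_inr, Prod.mk.injEq] at h <;> omega
    · rintro ⟨w, v⟩
      have hw : w % 3 = 0 ∨ w % 3 = 1 ∨ w % 3 = 2 := by omega
      rcases hw with hw | hw | hw
      · refine Or.inl ⟨Sum.inr (v - w / 3, -(w / 3)), ?_⟩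
        simp only [classes, Sum.elim_inr, Prod.mk.injEq]
        omega
      · refine Or.inr ⟨(w / 3 - v, w / 3), ?_⟩
        simp only [rest, Prod.mk.injEq]
        omega
      · refine Or.inl ⟨Sum.inl (w / 3 + 1 - v, w / 3 + 1), ?_⟩
        simp only [classes, Sum.elim_inl, Prod.mk.injEq]
        omega
  rw [hasSum_latticeTerm_theta.unique h6]
  ring

/-! ### Parity dissection and the recursion for P* -/

/-- The dissection of `f_1^4 f_5^4` by the parity of the exponent. -/
theorem eulerF_pow_four_dissection :
    eulerF 1 ^ 4 * eulerF 5 ^ 4 =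
      eulerF 2 ^ 2 * eulerF 10 ^ 2 *
          (thetaPhi 2 ^ 2 * thetaPhi 10 ^ 2 + X ^ 6 * (thetaPsi 4 ^ 2 * thetaPsi 20 ^ 2)) -
        X * (4 * (eulerF 2 ^ 4 * eulerF 10 ^ 4) + 8 * X ^ 2 * (eulerF 4 ^ 4 * eulerF 20 ^ 4)) := by
  have g1 := eulerF_sq (k := 1) le_rfl
  have g5 := eulerF_sq (k := 5) (by omega)
  have l1 := thetaPhiNeg_sq (k := 1) le_rfl
  have l5 := thetaPhiNeg_sq (k := 5) (by omega)
  have p1 := eulerF_mul_thetaPsi (k := 2) (by omega)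
  have p5 := eulerF_mul_thetaPsi (k := 10) (by omega)
  have s1 := thetaPsi_sq (k := 2) (by omega)
  have s5 := thetaPsi_sq (k := 10) (by omega)
  have w := congrArg (expand 2 two_ne_zero) two_mul_eulerF_one_mul_eulerF_five
  simp only [map_sub, map_mul, map_ofNat, expand_X, expand_eulerF, expand_thetaPhi, expand_thetaPsi,
    le_refl, Nat.one_le_ofNat] at w
  norm_num at g1 g5 l1 l5 p1 p5 s1 s5 w
  -- The doubling lets the cross term of the squared identity match `hsq` without division.
  have hB : 2 * (eulerF 2 ^ 2 * eulerF 10 ^ 2 *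
      (thetaPsi 4 ^ 2 * thetaPhi 10 ^ 2 + X ^ 4 * (thetaPhi 2 ^ 2 * thetaPsi 20 ^ 2))) =
      2 * (4 * (eulerF 2 ^ 4 * eulerF 10 ^ 4) + 8 * X ^ 2 * (eulerF 4 ^ 4 * eulerF 20 ^ 4)) := by
    have hsq : (eulerF 2 * thetaPsi 2) ^ 2 * (eulerF 10 * thetaPsi 10) ^ 2 =
      16 * (eulerF 4 ^ 4 * eulerF 20 ^ 4) := by rw [p1, p5]; ring
    rw [mul_pow, mul_pow, s1, s5] at hsq
    have hw : (2 * (eulerF 2 * eulerF 10)) ^ 2 = _ := congrArg (· ^ 2) w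
    linear_combination (-2) * eulerF 2 ^ 2 * eulerF 10 ^ 2 * hw + X ^ 2 * hsq
  have h2 : (2 : ℤ⟦X⟧) ≠ 0 := fun h => by
    have := congrArg constantCoeff h
    rw [map_ofNat, map_zero] at this
    omega
  have hB' := mul_left_cancel₀ h2 hB
  have h1 : eulerF 1 ^ 4 * eulerF 5 ^ 4 =
      eulerF 2 ^ 2 * eulerF 10 ^ 2 * (thetaPhiNeg 1 ^ 2 * thetaPhiNeg 5 ^ 2) := by
    rw [show eulerF 1 ^ 4 * eulerF 5 ^ 4 = (eulerF 1 ^ 2) ^ 2 * (eulerF 5 ^ 2) ^ 2 by ring, g1, g5]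
    ring
  rw [h1, l1, l5]
  linear_combination (-X) * hB'

theorem coeff_two_mul_add_one_expand (f : ℤ⟦X⟧) (n : ℕ) :
    coeff (2 * n + 1) (expand 2 two_ne_zero f) = 0 :=
  coeff_expand_of_not_dvd _ _ _ (by omega)

/-- The action of the Hecke operator at `2`. -/
theorem Pstar_two_mul_add_one (n : ℕ) :
    Pstar (2 * n + 1) = -(4 * Pstar n +
      8 * coeff n (X * expand 2 two_ne_zero (eulerF 1 ^ 4 * eulerF 5 ^ 4))) := by
  have h : eulerF 1 ^ 4 * eulerF 5 ^ 4 =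
      expand 2 two_ne_zero (eulerF 1 ^ 2 * eulerF 5 ^ 2 *
          (thetaPhi 1 ^ 2 * thetaPhi 5 ^ 2 + X ^ 3 * (thetaPsi 2 ^ 2 * thetaPsi 10 ^ 2))) -
        X * expand 2 two_ne_zero (4 * (eulerF 1 ^ 4 * eulerF 5 ^ 4) +
          8 * (X * expand 2 two_ne_zero (eulerF 1 ^ 4 * eulerF 5 ^ 4))) := by
    conv_lhs => rw [eulerF_pow_four_dissection]
    simp only [map_add, map_mul, map_pow, map_ofNat, expand_X, expand_eulerF, expand_thetaPhi,
      expand_thetaPsi, le_refl, Nat.one_le_ofNat, Nat.reduceMul]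
    ring
  have h4 : ∀ (m : ℤ) (f : ℤ⟦X⟧), coeff n (C m * f) = m * coeff n f := fun m f => coeff_C_mul _ _ _
  have e4 : (4 : ℤ⟦X⟧) = C 4 := by simp
  have e8 : (8 : ℤ⟦X⟧) = C 8 := by simp
  have hP : Pstar (2 * n + 1) = coeff (2 * n + 1) _ := congrArg (coeff (2 * n + 1)) h
  rw [hP, map_sub, coeff_two_mul_add_one_expand, coeff_succ_X_mul, coeff_expand_mul, map_add,
    e4, e8, h4, h4, zero_sub, Pstar]

/-- At an even index the second Hecke term vanishes, since q F(q^2) has only odd exponents. -/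
theorem Pstar_four_mul_add_one (n : ℕ) : Pstar (4 * n + 1) = -4 * Pstar (2 * n) := by
  have h := Pstar_two_mul_add_one (2 * n)
  have h0 : coeff (2 * n) (X * expand 2 two_ne_zero (eulerF 1 ^ 4 * eulerF 5 ^ 4)) = 0 := by
    cases n with
    | zero => simp
    | succ n =>
      rw [show 2 * (n + 1) = 2 * n + 1 + 1 by ring, coeff_succ_X_mul, coeff_two_mul_add_one_expand]
  rw [h0] at h
  rw [show 4 * n + 1 = 2 * (2 * n) + 1 by ring, h]
  ring

theorem Pstar_four_mul_add_three (n : ℕ) :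
    Pstar (4 * n + 3) = -4 * Pstar (2 * n + 1) - 8 * Pstar n := by
  have h := Pstar_two_mul_add_one (2 * n + 1)
  rw [coeff_succ_X_mul, coeff_expand_mul] at h
  rw [show 4 * n + 3 = 2 * (2 * n + 1) + 1 by ring, h, Pstar, Pstar]
  ring

end

theorem theorem1p1 :
    (∀ n : ℕ, Pstar (2 * n + 1) ≡ 0 [ZMOD 4]) ∧
    (∀ n : ℕ, Pstar (4 * n + 3) ≡ 0 [ZMOD 8]) ∧
    (∀ n : ℕ, Pstar (16 * n + 7) = 0) := by
  have h2 : ∀ n, (4 : ℤ) ∣ Pstar (2 * n + 1) := fun n => by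
    rw [Pstar_two_mul_add_one, mul_comm 8, ← show (4 : ℤ) * 2 = 8 by norm_num]
    exact (Dvd.dvd.mul_left (dvd_mul_right _ _) _ |> (dvd_mul_right _ _).add).neg_right
  refine ⟨fun n => Int.modEq_zero_iff_dvd.mpr (h2 n), fun n => Int.modEq_zero_iff_dvd.mpr ?_,
    fun n => ?_⟩
  · have h := h2 n
    rw [Pstar_four_mul_add_three]
    omega
  -- With a = P*(2n), the recursion gives P*(4n+1) = -4a, P*(8n+3) = 16a - 8a = 8a and P*(16n+7) =
  -- -32a + 32a = 0.
  · have h7 := Pstar_four_mul_add_three (4 * n + 1)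
    have h3 := Pstar_four_mul_add_three (2 * n)
    have h1 := Pstar_four_mul_add_one n
    ring_nf at h7 h3 h1 ⊢
    linarith
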